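/- Let $H$ be a group and let $\Gamma$ be a non-empty simple graph on which $H$ acts by graph automorphisms (elements of $H$ may invert edges). Let $A$ be a non-trivial group. The graph product $A^\Gamma$ is the quotient of the free product of copies $A_v$ of $A$, one for each vertex $v$ of $\Gamma$, by the relations $[a,b]=1$ for all $a\in A_u$, $b\in A_v$ with $u,v$ joined by an edge of $\Gamma$. The group $H$ acts on $A^\Gamma$ by automorphisms, with $h\in H$ carrying $A_v$ identically to $A_{hv}$. Let $G=A\wr_\Gamma H$ be the graph-wreath product $A^\Gamma\rtimes H$ formed with this action. Then $G$ is finitely presented if and only if the following three conditions hold: (1) $A$ and $H$ are finitely presented; (2) $H$ has finitely many orbits on the set of vertices of $\Gamma$ and finitely many orbits on the set of (unoriented) edges of $\Gamma$; (3) the stabilizer in $H$ of each vertex of $\Gamma$ is finitely generated. -/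

import Mathlib

/-- The commutators in the free product `⋆_v A v` of elements lying over vertices that are joined
by an edge of `Γ`. -/
def GraphProduct.rels {V : Type*} (Γ : SimpleGraph V) (A : V → Type*) [∀ v, Group (A v)] :
    Set (Monoid.CoprodI A) :=
  {x | ∃ (u v : V) (_ : Γ.Adj u v) (a : A u) (b : A v),
    x = (Monoid.CoprodI.of a * Monoid.CoprodI.of b) *
      (Monoid.CoprodI.of a)⁻¹ * (Monoid.CoprodI.of b)⁻¹}

/-- The graph product of a family of groups over a simple graph: the quotient of the free product
by the normal subgroup generated by the commutators of elements over adjacent vertices. -/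
def GraphProduct {V : Type*} (Γ : SimpleGraph V) (A : V → Type*) [∀ v, Group (A v)] : Type _ :=
  Monoid.CoprodI A ⧸ Subgroup.normalClosure (GraphProduct.rels Γ A)

namespace GraphProduct

instance instGroup {V : Type*} (Γ : SimpleGraph V) (A : V → Type*) [∀ v, Group (A v)] :
    Group (GraphProduct Γ A) :=
  inferInstanceAs
    (Group (Monoid.CoprodI A ⧸ Subgroup.normalClosure (GraphProduct.rels Γ A)))

/-- The canonical homomorphism from a vertex group to the graph product. -/
def of {V : Type*} (Γ : SimpleGraph V) {A : V → Type*} [∀ v, Group (A v)] (v : V) :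
    A v →* GraphProduct Γ A :=
  (QuotientGroup.mk' (Subgroup.normalClosure (GraphProduct.rels Γ A))).comp Monoid.CoprodI.of

theorem commute_of {V : Type*} (Γ : SimpleGraph V) {A : V → Type*} [∀ v, Group (A v)] {u v : V}
    (h : Γ.Adj u v) (a : A u) (b : A v) : Commute (of Γ u a) (of Γ v b) := by
  have h1 : of Γ u a * of Γ v b * (of Γ u a)⁻¹ * (of Γ v b)⁻¹ = 1 :=
    (QuotientGroup.eq_one_iff _).2 (Subgroup.subset_normalClosure ⟨u, v, h, a, b, rfl⟩)
  exact mul_inv_eq_iff_eq_mul.1 (mul_inv_eq_one.1 h1)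

/-- The universal property of the graph product. -/
def lift {V : Type*} (Γ : SimpleGraph V) {A : V → Type*} [∀ v, Group (A v)] {K : Type*} [Group K]
    (f : ∀ v, A v →* K)
    (hf : ∀ u v, Γ.Adj u v → ∀ (a : A u) (b : A v), Commute (f u a) (f v b)) :
    GraphProduct Γ A →* K :=
  QuotientGroup.lift (Subgroup.normalClosure (rels Γ A)) (Monoid.CoprodI.lift f) (by
    intro x hx
    have hle : Subgroup.normalClosure (rels Γ A) ≤ (Monoid.CoprodI.lift f).ker := by
      refine Subgroup.normalClosure_le_normal ?_
      rintro _ ⟨u, v, huv, a, b, rfl⟩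
      rw [SetLike.mem_coe, MonoidHom.mem_ker, map_mul, map_mul, map_mul, map_inv, map_inv,
        Monoid.CoprodI.lift_of, Monoid.CoprodI.lift_of, (hf u v huv a b).eq]
      group
    exact hle hx)

@[simp]
theorem lift_of {V : Type*} (Γ : SimpleGraph V) {A : V → Type*} [∀ v, Group (A v)] {K : Type*}
    [Group K] (f : ∀ v, A v →* K)
    (hf : ∀ u v, Γ.Adj u v → ∀ (a : A u) (b : A v), Commute (f u a) (f v b)) (v : V) (a : A v) :
    lift Γ f hf (of Γ v a) = f v a :=
  Monoid.CoprodI.lift_of f a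

theorem hom_ext {V : Type*} (Γ : SimpleGraph V) {A : V → Type*} [∀ v, Group (A v)] {K : Type*}
    [Group K] {f g : GraphProduct Γ A →* K} (h : ∀ v a, f (of Γ v a) = g (of Γ v a)) : f = g := by
  apply QuotientGroup.monoidHom_ext
  apply Monoid.CoprodI.ext_hom
  intro v
  ext a
  exact h v a

end GraphProduct

/-- The action of `H` on the vertex set of `Γ` is by graph automorphisms (elements of `H` are
allowed to invert edges), that is, `Γ` is a simple `H`-graph. -/
class SimpleGraph.IsGraphAction (H : Type*) [Group H] {V : Type*} [MulAction H V]
    (Γ : SimpleGraph V) : Prop where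
  smul_adj_smul : ∀ (h : H) (u v : V), Γ.Adj (h • u) (h • v) ↔ Γ.Adj u v

/-- The induced action on the set of (unoriented) edges. -/
instance SimpleGraph.edgeSetMulAction (H : Type*) [Group H] {V : Type*} [MulAction H V]
    (Γ : SimpleGraph V) [Γ.IsGraphAction H] : MulAction H Γ.edgeSet where
  smul h e := ⟨Sym2.map (fun v => h • v) e.1, by
    obtain ⟨e, he⟩ := e
    induction e with
    | _ u v => exact (SimpleGraph.IsGraphAction.smul_adj_smul h u v).2 he⟩
  one_smul e := by
    apply Subtype.ext
    change Sym2.map (fun v => (1 : H) • v) e.1 = e.1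
    simp
  mul_smul g h e := by
    apply Subtype.ext
    change Sym2.map (fun v => (g * h) • v) e.1
      = Sym2.map (fun v => g • v) (Sym2.map (fun v => h • v) e.1)
    rw [Sym2.map_map]
    congr 1
    funext v
    exact mul_smul g h v

namespace GraphProduct

/-- The endomorphism of `A^Γ` induced by `h`: it carries the copy of `A` over `v` identically to
the copy of `A` over `h • v`. -/
def smulHom (A : Type*) [Group A] {H : Type*} [Group H] {V : Type*} [MulAction H V]
    (Γ : SimpleGraph V) [Γ.IsGraphAction H] (h : H) :
    GraphProduct Γ (fun _ => A) →* GraphProduct Γ (fun _ => A) :=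
  lift Γ (fun v => of Γ (A := fun _ => A) (h • v)) (fun u v huv a b =>
    commute_of Γ (A := fun _ => A)
      ((SimpleGraph.IsGraphAction.smul_adj_smul h u v).2 huv) a b)

@[simp]
theorem smulHom_of (A : Type*) [Group A] {H : Type*} [Group H] {V : Type*} [MulAction H V]
    (Γ : SimpleGraph V) [Γ.IsGraphAction H] (h : H) (v : V) (a : A) :
    smulHom A Γ h (of Γ (A := fun _ => A) v a) = of Γ (A := fun _ => A) (h • v) a :=
  lift_of Γ (A := fun _ => A) _ _ v a

theorem smulHom_one (A : Type*) [Group A] {H : Type*} [Group H] {V : Type*} [MulAction H V]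
    (Γ : SimpleGraph V) [Γ.IsGraphAction H] : smulHom A Γ (1 : H) = MonoidHom.id _ :=
  hom_ext Γ fun v a => by rw [smulHom_of, one_smul, MonoidHom.id_apply]

theorem smulHom_mul (A : Type*) [Group A] {H : Type*} [Group H] {V : Type*} [MulAction H V]
    (Γ : SimpleGraph V) [Γ.IsGraphAction H] (g h : H) :
    smulHom A Γ (g * h) = (smulHom A Γ g).comp (smulHom A Γ h) :=
  hom_ext Γ fun v a => by
    rw [MonoidHom.comp_apply, smulHom_of, smulHom_of, smulHom_of, mul_smul]

/-- The action of `H` on the graph product `A^Γ` by group automorphisms induced by the action of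
`H` on `Γ`. -/
def action (A H : Type*) [Group A] [Group H] {V : Type*} [MulAction H V]
    (Γ : SimpleGraph V) [Γ.IsGraphAction H] : H →* MulAut (GraphProduct Γ (fun _ => A)) where
  toFun h := MonoidHom.toMulEquiv (smulHom A Γ h) (smulHom A Γ h⁻¹)
    (by rw [← smulHom_mul, inv_mul_cancel, smulHom_one])
    (by rw [← smulHom_mul, mul_inv_cancel, smulHom_one])
  map_one' := MulEquiv.ext fun x => DFunLike.congr_fun (smulHom_one A Γ) x
  map_mul' g h := MulEquiv.ext fun x => DFunLike.congr_fun (smulHom_mul A Γ g h) x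

end GraphProduct

/-- The graph-wreath product `A ≀_Γ H = A^Γ ⋊ H`. -/
abbrev GraphWreathProduct (A H : Type*) [Group A] [Group H] {V : Type*} [MulAction H V]
    (Γ : SimpleGraph V) [Γ.IsGraphAction H] : Type _ :=
  SemidirectProduct (GraphProduct Γ (fun _ => A)) H (GraphProduct.action A H Γ)

theorem Set.Finite.exists_finite_image_eq_of_subset_range {ι α : Type*} {F : ι → α} {u : Set α}
    (hu : u.Finite) (h : u ⊆ Set.range F) : ∃ X : Set ι, X.Finite ∧ F '' X = u := by
  choose g hg using h
  have := hu.to_subtype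
  refine ⟨Set.range fun x : u => g x.2, Set.finite_range _, Set.ext fun x => ⟨?_, fun hx => ?_⟩⟩
  · rintro ⟨_, ⟨y, rfl⟩, rfl⟩
    exact (hg y.2).symm ▸ y.2
  · exact ⟨_, ⟨⟨x, hx⟩, rfl⟩, hg hx⟩

theorem Subgroup.exists_finite_subset_of_mem_closure {G : Type*} [Group G] {s : Set G} {x : G}
    (hx : x ∈ Subgroup.closure s) : ∃ t ⊆ s, t.Finite ∧ x ∈ Subgroup.closure t := by
  induction hx using Subgroup.closure_induction with
  | mem x hx =>
    exact ⟨{x}, by simpa using hx, Set.finite_singleton x, Subgroup.subset_closure rfl⟩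
  | one => exact ⟨∅, Set.empty_subset s, Set.finite_empty, one_mem _⟩
  | mul x y _ _ ihx ihy =>
    obtain ⟨t, hts, ht, hxt⟩ := ihx
    obtain ⟨u, hus, hu, hyu⟩ := ihy
    exact ⟨t ∪ u, Set.union_subset hts hus, ht.union hu,
      mul_mem (Subgroup.closure_mono Set.subset_union_left hxt)
        (Subgroup.closure_mono Set.subset_union_right hyu)⟩
  | inv x _ ih =>
    obtain ⟨t, hts, ht, hxt⟩ := ih
    exact ⟨t, hts, ht, inv_mem hxt⟩

theorem Subgroup.exists_finite_subset_of_le_closure {G : Type*} [Group G] {s t : Set G}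
    (ht : t.Finite) (h : t ⊆ Subgroup.closure s) :
    ∃ u ⊆ s, u.Finite ∧ t ⊆ Subgroup.closure u := by
  choose! f hfs hf hmem using fun x (hx : x ∈ t) =>
    Subgroup.exists_finite_subset_of_mem_closure (h hx)
  exact ⟨⋃ x ∈ t, f x, Set.iUnion₂_subset hfs, ht.biUnion hf, fun x hx =>
    Subgroup.closure_mono (Set.subset_biUnion_of_mem hx) (hmem x hx)⟩

theorem Subgroup.exists_finite_subset_of_le_normalClosure {G : Type*} [Group G] {s t : Set G}
    (ht : t.Finite) (h : t ⊆ Subgroup.normalClosure s) :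
    ∃ u ⊆ s, u.Finite ∧ t ⊆ Subgroup.normalClosure u := by
  obtain ⟨c, hcs, hc, htc⟩ := Subgroup.exists_finite_subset_of_le_closure ht h
  choose! f hf hconj using fun x (hx : x ∈ c) => Group.mem_conjugatesOfSet_iff.1 (hcs hx)
  refine ⟨f '' c, Set.image_subset_iff.2 hf, hc.image f, htc.trans ?_⟩
  refine Subgroup.closure_mono fun x hx => ?_
  exact Group.mem_conjugatesOfSet_iff.2 ⟨f x, Set.mem_image_of_mem f hx, hconj x hx⟩

theorem Group.FG.exists_finite_closure_image {G ι : Type*} [Group G] [hG : Group.FG G] (F : ι → G)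
    (hF : Subgroup.closure (Set.range F) = ⊤) :
    ∃ X : Set ι, X.Finite ∧ Subgroup.closure (F '' X) = ⊤ := by
  obtain ⟨t, htop, ht⟩ := Group.fg_iff.1 hG
  obtain ⟨u, hus, hu, htu⟩ := Subgroup.exists_finite_subset_of_le_closure (s := Set.range F) ht
    (by simp [hF])
  obtain ⟨X, hX, rfl⟩ := Set.Finite.exists_finite_image_eq_of_subset_range hu hus
  exact ⟨X, hX, top_le_iff.1 (htop ▸ (Subgroup.closure_le _).2 htu)⟩

theorem Group.IsFinitelyPresented.fg (G : Type*) [Group G] [hG : Group.IsFinitelyPresented G] :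
    Group.FG G := by
  obtain ⟨n, φ, hφ, -⟩ := hG.out
  exact Group.fg_iff_exists_freeGroup_hom_surjective_finite.2 ⟨Fin n, inferInstance, φ, hφ⟩

theorem Group.FG.exists_freeGroup_fin (G : Type*) [Group G] [hG : Group.FG G] :
    ∃ (n : ℕ) (φ : FreeGroup (Fin n) →* G), Function.Surjective φ := by
  obtain ⟨α, _, φ, hφ⟩ := Group.fg_iff_exists_freeGroup_hom_surjective_finite.1 hG
  obtain ⟨n, ⟨e⟩⟩ := Finite.exists_equiv_fin α
  exact ⟨n, φ.comp (FreeGroup.freeGroupCongr e).symm.toMonoidHom,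
    hφ.comp (FreeGroup.freeGroupCongr e).symm.surjective⟩

theorem MonoidHom.ker_le_of_section_mk {K G : Type*} [Group K] [Group G] (π : K →* G)
    {N : Subgroup K} [N.Normal] (σ : G →* K ⧸ N) (h : σ.comp π = QuotientGroup.mk' N) :
    π.ker ≤ N := by
  intro k hk
  rw [← QuotientGroup.ker_mk' N, ← h, MonoidHom.mem_ker, MonoidHom.comp_apply,
    MonoidHom.mem_ker.1 hk, map_one]

theorem MonoidHom.exists_comp_eq_of_surjective {F A Q : Type*} [Group F] [Group A] [Group Q]
    (φ : F →* A) (hφ : Function.Surjective φ) (g : F →* Q) (h : φ.ker ≤ g.ker) :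
    ∃ f : A →* Q, ∀ x, f (φ x) = g x :=
  ⟨φ.liftOfSurjective hφ ⟨g, h⟩, fun x => φ.liftOfRightInverse_comp_apply _ _ ⟨g, h⟩ x⟩

/-- A finitely generated extension of a finitely presented group has a kernel that is finitely
generated as a normal subgroup. -/
theorem Group.IsFinitelyPresented.ker_isFinitelyNormallyGenerated {K G : Type*} [Group K] [Group G]
    [hK : Group.FG K] [hG : Group.IsFinitelyPresented G] (π : K →* G)
    (hπ : Function.Surjective π) : π.ker.IsFinitelyNormallyGenerated := by
  obtain ⟨n, φ, hφ, S, hS, hker⟩ := hG.out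
  obtain ⟨T, hT, hTfin⟩ := Group.fg_iff.1 hK
  obtain ⟨ψ, hψ⟩ : ∃ ψ : FreeGroup (Fin n) →* K, π.comp ψ = φ := by
    refine ⟨FreeGroup.lift fun i => Function.surjInv hπ (φ (FreeGroup.of i)), ?_⟩
    ext i
    simp [Function.surjInv_eq]
  have hψ' : ∀ x, π (ψ x) = φ x := DFunLike.congr_fun hψ
  choose w hw using fun k : K => hφ (π k)
  refine ⟨ψ '' S ∪ (fun k => k * (ψ (w k))⁻¹) '' T, (hS.image _).union (hTfin.image _),
    le_antisymm (Subgroup.normalClosure_le_normal ?_) ?_⟩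
  · rintro _ (⟨s, hs, rfl⟩ | ⟨k, -, rfl⟩)
    · have : s ∈ φ.ker := hker ▸ Subgroup.subset_normalClosure hs
      rw [SetLike.mem_coe, MonoidHom.mem_ker, hψ', MonoidHom.mem_ker.1 this]
    · rw [SetLike.mem_coe, MonoidHom.mem_ker, map_mul, map_inv, hψ', hw, mul_inv_cancel]
  · set N := Subgroup.normalClosure (ψ '' S ∪ (fun k => k * (ψ (w k))⁻¹) '' T) with hN
    obtain ⟨σ, hσ⟩ := φ.exists_comp_eq_of_surjective hφ ((QuotientGroup.mk' N).comp ψ) (by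
      rw [← hker]
      refine Subgroup.normalClosure_le_normal fun s hs => ?_
      rw [SetLike.mem_coe, MonoidHom.mem_ker, MonoidHom.comp_apply]
      exact (QuotientGroup.eq_one_iff _).2
        (Subgroup.subset_normalClosure (Or.inl (Set.mem_image_of_mem ψ hs))))
    refine π.ker_le_of_section_mk σ (MonoidHom.eq_of_eqOn_dense hT fun k hk => ?_)
    rw [MonoidHom.comp_apply, ← hw, hσ, MonoidHom.comp_apply]
    refine (QuotientGroup.eq_iff_div_mem.2 ?_).symm
    rw [div_eq_mul_inv]
    exact Subgroup.subset_normalClosure (Or.inr ⟨k, hk, rfl⟩)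

/-- If a finitely presented group is the quotient of a finitely generated group by a family of
relations, then finitely many of these relations suffice. -/
theorem Group.IsFinitelyPresented.exists_finite_ker_le {K G ι : Type*} [Group K] [Group G]
    [Group.FG K] [Group.IsFinitelyPresented G] (π : K →* G)
    (hπ : Function.Surjective π) (F : ι → K)
    (hF : π.ker ≤ Subgroup.normalClosure (Set.range F)) :
    ∃ X : Set ι, X.Finite ∧ π.ker ≤ Subgroup.normalClosure (F '' X) := by
  obtain ⟨S, hS, hker⟩ := Group.IsFinitelyPresented.ker_isFinitelyNormallyGenerated π hπ
  obtain ⟨u, hus, hu, hSu⟩ := Subgroup.exists_finite_subset_of_le_normalClosure (s := Set.range F) hS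
    (Subgroup.subset_normalClosure.trans (hker.le.trans hF))
  obtain ⟨X, hX, rfl⟩ := Set.Finite.exists_finite_image_eq_of_subset_range hu hus
  exact ⟨X, hX, hker ▸ Subgroup.normalClosure_le_normal hSu⟩

/-- A retract of a finitely presented group is finitely presented. -/
theorem Group.IsFinitelyPresented.of_retract {G H : Type*} [Group G] [Group H]
    [hG : Group.IsFinitelyPresented G] (ρ : G →* H) (ι : H →* G) (h : ∀ x, ρ (ι x) = x) :
    Group.IsFinitelyPresented H := by
  have hρ : Function.Surjective ρ := fun x => ⟨ι x, h x⟩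
  obtain ⟨S, hS, hfin⟩ := Group.fg_iff.1 (Group.IsFinitelyPresented.fg G)
  refine Group.IsFinitelyPresented.of_surjective ρ hρ
    ⟨(fun g => g * (ι (ρ g))⁻¹) '' S, hfin.image _, le_antisymm ?_ ?_⟩
  · refine Subgroup.normalClosure_le_normal ?_
    rintro _ ⟨g, -, rfl⟩
    rw [SetLike.mem_coe, MonoidHom.mem_ker, map_mul, map_inv, h, mul_inv_cancel]
  · refine ρ.ker_le_of_section_mk ((QuotientGroup.mk' _).comp ι)
      (MonoidHom.eq_of_eqOn_dense hS fun g hg => ?_)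
    refine (QuotientGroup.eq_iff_div_mem.2 ?_).symm
    rw [div_eq_mul_inv]
    exact Subgroup.subset_normalClosure ⟨g, hg, rfl⟩

/-- Nontrivial elements of distinct factors of a free product do not commute. -/
theorem Monoid.CoprodI.not_commute_of {ι : Type*} {G : ι → Type*} [∀ i, Group (G i)] {i j : ι}
    (hij : i ≠ j) {a : G i} (ha : a ≠ 1) {b : G j} (hb : b ≠ 1) :
    ¬ Commute (Monoid.CoprodI.of a) (Monoid.CoprodI.of b) := by
  classical
  intro h
  have hne : (⟨i, a⟩ : Σ i, G i) ≠ ⟨j, b⟩ := fun h => hij (congrArg Sigma.fst h)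
  let w₁ := (NeWord.singleton a ha).append hij (NeWord.singleton b hb)
  let w₂ := (NeWord.singleton b hb).append hij.symm (NeWord.singleton a ha)
  have hw : w₁.prod = w₂.prod := by
    simpa only [w₁, w₂, NeWord.append_prod, NeWord.prod_singleton] using h.eq
  have hw' : w₁.toWord = w₂.toWord := Word.equiv.symm.injective hw
  have hl : w₁.toList = w₂.toList := congrArg Word.toList hw'
  exact hne (List.cons.inj hl).1

namespace GraphProduct

section Projections

variable {V A : Type*} [Group A] (Γ : SimpleGraph V)

/-- The retraction of a graph product onto the vertex group over `v`. -/
noncomputable def proj (v : V) : GraphProduct Γ (fun _ => A) →* A :=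
  open Classical in
  lift Γ (fun w => if w = v then MonoidHom.id A else 1) (fun u w huw a b => by
    by_cases hu : u = v
    · have hw : w ≠ v := fun hw => huw.ne (hu.trans hw.symm)
      simp [hw]
    · simp [hu])

@[simp]
theorem proj_of_self (v : V) (a : A) : proj Γ v (of Γ (A := fun _ => A) v a) = a := by
  simp [proj]

theorem proj_of_ne {v w : V} (h : w ≠ v) (a : A) :
    proj Γ v (of Γ (A := fun _ => A) w a) = 1 := by
  simp [proj, h]

theorem of_injective (v : V) : Function.Injective (of Γ (A := fun _ => A) v) :=
  Function.LeftInverse.injective (proj_of_self Γ v)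

theorem of_eq_of_iff {v w : V} {a : A} (ha : a ≠ 1) :
    of Γ (A := fun _ => A) v a = of Γ (A := fun _ => A) w a ↔ v = w := by
  refine ⟨fun h => ?_, fun h => h ▸ rfl⟩
  by_contra hvw
  apply ha
  rw [← proj_of_self Γ v a, h, proj_of_ne Γ (Ne.symm hvw)]

theorem adj_of_commute {v w : V} (hvw : v ≠ w) {a b : A} (ha : a ≠ 1) (hb : b ≠ 1)
    (h : Commute (of Γ (A := fun _ => A) v a) (of Γ (A := fun _ => A) w b)) : Γ.Adj v w := by
  classical
  by_contra hadj
  let f : V → A →* Monoid.CoprodI (fun _ : V => A) := fun u =>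
    if u = v then Monoid.CoprodI.of (M := fun _ : V => A) (i := v)
    else if u = w then Monoid.CoprodI.of (M := fun _ : V => A) (i := w) else 1
  have hf : ∀ u u', Γ.Adj u u' → ∀ a b : A, Commute (f u a) (f u' b) := by
    intro u u' huu' a b
    by_cases h1 : u = v
    · have h2 : u' ≠ v := fun h => huu'.ne (h1.trans h.symm)
      have h3 : u' ≠ w := fun h => hadj (h1 ▸ h ▸ huu')
      simp [f, h2, h3]
    · by_cases h2 : u = w
      · have h3 : u' ≠ v := fun h => hadj ((h2 ▸ h ▸ huu').symm)
        have h4 : u' ≠ w := fun h => huu'.ne (h2.trans h.symm)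
        simp [f, h3, h4]
      · simp [f, h1, h2]
  refine Monoid.CoprodI.not_commute_of (G := fun _ : V => A) hvw ha hb ?_
  simpa [f, hvw.symm] using h.map (lift Γ f hf)

end Projections

theorem action_apply {A H V : Type*} [Group A] [Group H] [MulAction H V]
    (Γ : SimpleGraph V) [Γ.IsGraphAction H] (h : H) (x : GraphProduct Γ (fun _ => A)) :
    action A H Γ h x = smulHom A Γ h x :=
  rfl

theorem proj_action {A H V : Type*} [Group A] [Group H] [MulAction H V]
    (Γ : SimpleGraph V) [Γ.IsGraphAction H] (h : H) (v : V) (x : GraphProduct Γ (fun _ => A)) :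
    proj Γ v (action A H Γ h x) = proj Γ (h⁻¹ • v) x := by
  rw [action_apply]
  refine DFunLike.congr_fun (f := (proj Γ v).comp (smulHom A Γ h)) (hom_ext Γ fun w a => ?_) x
  rw [MonoidHom.comp_apply, smulHom_of]
  by_cases hw : w = h⁻¹ • v
  · subst hw
    rw [smul_inv_smul, proj_of_self, proj_of_self]
  · rw [proj_of_ne Γ hw, proj_of_ne Γ fun hv => hw (eq_inv_smul_iff.2 hv)]

end GraphProduct

namespace GraphWreathProduct

open SemidirectProduct

variable {A H V : Type*} [Group A] [Group H] [MulAction H V]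
  (Γ : SimpleGraph V) [Γ.IsGraphAction H]

/-- The canonical homomorphism from the copy of `A` over `v` to the graph-wreath product. -/
def ofVertex (v : V) : A →* GraphWreathProduct A H Γ :=
  inl.comp (GraphProduct.of Γ (A := fun _ => A) v)

theorem conj_ofVertex (h : H) (v : V) (a : A) :
    (inr h : GraphWreathProduct A H Γ) * ofVertex Γ v a * (inr h)⁻¹ = ofVertex Γ (h • v) a := by
  rw [← map_inv, ofVertex, MonoidHom.comp_apply, ← inl_aut, GraphProduct.action_apply,
    GraphProduct.smulHom_of]
  rfl

theorem commute_ofVertex {u v : V} (h : Γ.Adj u v) (a b : A) :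
    Commute (ofVertex Γ u a : GraphWreathProduct A H Γ) (ofVertex Γ v b) :=
  (GraphProduct.commute_of Γ (A := fun _ => A) h a b).map inl

theorem ofVertex_injective (v : V) :
    Function.Injective (ofVertex Γ v : A →* GraphWreathProduct A H Γ) :=
  inl_injective.comp (GraphProduct.of_injective Γ v)

theorem ofVertex_eq_iff {v w : V} {a : A} (ha : a ≠ 1) :
    (ofVertex Γ v a : GraphWreathProduct A H Γ) = ofVertex Γ w a ↔ v = w :=
  inl_inj.trans (GraphProduct.of_eq_of_iff Γ ha)

theorem adj_of_commute {v w : V} (hvw : v ≠ w) {a b : A} (ha : a ≠ 1) (hb : b ≠ 1)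
    (h : Commute (ofVertex Γ v a : GraphWreathProduct A H Γ) (ofVertex Γ w b)) : Γ.Adj v w :=
  GraphProduct.adj_of_commute Γ hvw ha hb (inl_injective (by simpa [ofVertex] using h.eq))

/-- The universal property of the graph-wreath product. -/
def lift {Q : Type*} [Group Q] (f : V → A →* Q) (g : H →* Q)
    (hf : ∀ u v, Γ.Adj u v → ∀ a b : A, Commute (f u a) (f v b))
    (hg : ∀ h v a, g h * f v a * (g h)⁻¹ = f (h • v) a) : GraphWreathProduct A H Γ →* Q :=
  SemidirectProduct.lift (GraphProduct.lift Γ f hf) g fun h => GraphProduct.hom_ext Γ fun v a => by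
    simp [GraphProduct.action_apply, hg]

section lift

variable {Q : Type*} [Group Q] (f : V → A →* Q) (g : H →* Q)
    (hf : ∀ u v, Γ.Adj u v → ∀ a b : A, Commute (f u a) (f v b))
    (hg : ∀ h v a, g h * f v a * (g h)⁻¹ = f (h • v) a)

@[simp]
theorem lift_ofVertex (v : V) (a : A) : lift Γ f g hf hg (ofVertex Γ v a) = f v a := by
  simp [lift, ofVertex]

@[simp]
theorem lift_inr (h : H) : lift Γ f g hf hg (inr h) = g h := by
  simp [lift]

end lift

theorem hom_ext {Q : Type*} [Group Q] {f g : GraphWreathProduct A H Γ →* Q}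
    (hv : ∀ v a, f (ofVertex Γ v a) = g (ofVertex Γ v a)) (hr : ∀ h, f (inr h) = g (inr h)) :
    f = g :=
  SemidirectProduct.hom_ext (GraphProduct.hom_ext Γ hv) (MonoidHom.ext hr)

/-- A subgroup containing `H` and a copy of `A` over each orbit is everything. -/
theorem eq_top_of_mem {ι : Type*} (r : ι → V) (hr : ∀ v, ∃ i, ∃ h : H, h • r i = v)
    (C : Subgroup (GraphWreathProduct A H Γ)) (hH : ∀ h, inr h ∈ C)
    (hA : ∀ i a, ofVertex Γ (r i) a ∈ C) : C = ⊤ := by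
  have hv : ∀ v a, ofVertex Γ v a ∈ C := by
    intro v a
    obtain ⟨i, h, rfl⟩ := hr v
    rw [← conj_ofVertex]
    exact mul_mem (mul_mem (hH h) (hA i a)) (inv_mem (hH h))
  let s : GraphWreathProduct A H Γ →* C := lift Γ (fun v => (ofVertex Γ v).codRestrict C (hv v))
    (inr.codRestrict C hH) (fun u v huv a b => Subtype.ext (commute_ofVertex Γ huv a b))
    (fun h v a => Subtype.ext (conj_ofVertex Γ h v a))
  have hs : C.subtype.comp s = MonoidHom.id _ :=
    hom_ext Γ (fun v a => congrArg Subtype.val (lift_ofVertex ..))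
      (fun h => congrArg Subtype.val (lift_inr ..))
  refine top_le_iff.1 fun x _ => ?_
  rw [← MonoidHom.id_apply _ x, ← hs]
  exact (s x).2

theorem closure_range_eq_top : Subgroup.closure (Set.range (Sum.elim
    (fun p : V × A => ofVertex Γ p.1 p.2) (fun h : H => inr h))) =
    (⊤ : Subgroup (GraphWreathProduct A H Γ)) :=
  eq_top_of_mem Γ id (fun v => ⟨v, 1, one_smul H v⟩) _
    (fun h => Subgroup.subset_closure ⟨Sum.inr h, rfl⟩)
    (fun v a => Subgroup.subset_closure ⟨Sum.inl (v, a), rfl⟩)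

theorem fg_of_orbits {ι : Type*} [Finite ι] [hA : Group.FG A] [hH : Group.FG H] (r : ι → V)
    (hr : ∀ v, ∃ i, ∃ h : H, h • r i = v) : Group.FG (GraphWreathProduct A H Γ) := by
  obtain ⟨S, hS, hSfin⟩ := Group.fg_iff.1 hA
  obtain ⟨T, hT, hTfin⟩ := Group.fg_iff.1 hH
  let U : Set (GraphWreathProduct A H Γ) := (inr '' T) ∪ ⋃ i, ofVertex Γ (r i) '' S
  refine Group.fg_iff.2 ⟨U, eq_top_of_mem Γ r hr _ ?_ ?_,
    (hTfin.image _).union (Set.finite_iUnion fun i => hSfin.image _)⟩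
  · have : ⊤ ≤ (Subgroup.closure U).comap (inr : H →* GraphWreathProduct A H Γ) := by
      rw [← hT, Subgroup.closure_le]
      exact fun t ht => Subgroup.subset_closure (Or.inl ⟨t, ht, rfl⟩)
    exact fun h => this (Subgroup.mem_top h)
  · intro i
    have : ⊤ ≤ (Subgroup.closure U).comap
        (ofVertex Γ (r i) : A →* GraphWreathProduct A H Γ) := by
      rw [← hS, Subgroup.closure_le]
      exact fun t ht => Subgroup.subset_closure (Or.inr (Set.mem_iUnion.2 ⟨i, t, ht, rfl⟩))
    exact fun a => this (Subgroup.mem_top a)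

theorem surjective_of_mem_range {K : Type*} [Group K] {ι : Type*} (r : ι → V)
    (hr : ∀ v, ∃ i, ∃ h : H, h • r i = v) (π : K →* GraphWreathProduct A H Γ)
    (hH : ∀ h, inr h ∈ π.range) (hA : ∀ i a, ofVertex Γ (r i) a ∈ π.range) :
    Function.Surjective π :=
  MonoidHom.range_eq_top.1 (eq_top_of_mem Γ r hr _ hH hA)

/-- The homomorphism of graph-wreath products induced by a homomorphism of the vertex groups and an
equivariant graph homomorphism. -/
def map {B W : Type*} [Group B] [MulAction H W] (φ : A →* B) (Δ : SimpleGraph W)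
    [Δ.IsGraphAction H] (p : V → W) (hp : ∀ (h : H) v, p (h • v) = h • p v)
    (hadj : ∀ u v, Γ.Adj u v → Δ.Adj (p u) (p v)) :
    GraphWreathProduct A H Γ →* GraphWreathProduct B H Δ :=
  lift Γ (fun v => (ofVertex Δ (p v)).comp φ) inr
    (fun u v huv a b => commute_ofVertex Δ (hadj u v huv) (φ a) (φ b))
    (fun h v a => by simp [conj_ofVertex, hp])

section map

variable {B W : Type*} [Group B] [MulAction H W] (φ : A →* B) (Δ : SimpleGraph W)
    [Δ.IsGraphAction H] (p : V → W) (hp : ∀ (h : H) v, p (h • v) = h • p v)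
    (hadj : ∀ u v, Γ.Adj u v → Δ.Adj (p u) (p v))

@[simp]
theorem map_ofVertex (v : V) (a : A) :
    map Γ φ Δ p hp hadj (ofVertex Γ v a) = ofVertex Δ (p v) (φ a) := by
  simp [map]

@[simp]
theorem map_inr (h : H) : map Γ φ Δ p hp hadj (inr h) = inr h := by
  simp [map]

theorem map_surjective (hφ : Function.Surjective φ) (hps : ∀ w, ∃ v, ∃ h : H, h • p v = w) :
    Function.Surjective (map Γ φ Δ p hp hadj) := by
  refine surjective_of_mem_range Δ p hps _ (fun h => ⟨inr h, map_inr ..⟩) fun v b => ?_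
  obtain ⟨a, rfl⟩ := hφ b
  exact ⟨ofVertex Γ v a, map_ofVertex ..⟩

end map

theorem exists_smul_out (v : V) :
    ∃ h : H, h • (Quotient.mk (MulAction.orbitRel H V) v).out = v :=
  MulAction.orbitRel_apply.1 ((MulAction.orbitRel H V).symm (Quotient.mk_out (s := MulAction.orbitRel H V) v))

/-- A family of homomorphisms over representatives of the orbits that is compatible with the
stabilizers extends to an equivariant family over all vertices. -/
theorem exists_equivariant_family {Q : Type*} [Group Q]
    (f : MulAction.orbitRel.Quotient H V → A →* Q) (g : H →* Q)
    (hstab : ∀ i, ∀ s ∈ MulAction.stabilizer H (Quotient.out i), ∀ a, Commute (g s) (f i a)) :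
    ∃ F : V → A →* Q, (∀ h v a, g h * F v a * (g h)⁻¹ = F (h • v) a) ∧
      ∀ i a, F (Quotient.out i) a = f i a := by
  let ρ : V → MulAction.orbitRel.Quotient H V := Quotient.mk (MulAction.orbitRel H V)
  choose c hc using exists_smul_out (H := H) (V := V)
  have hρ : ∀ (h : H) i, ρ (h • Quotient.out i) = i := fun h i => by
    conv_rhs => rw [← Quotient.out_eq i]
    exact Quotient.sound (s := MulAction.orbitRel H V) ⟨h, rfl⟩
  let F : V → A →* Q := fun v => (MulAut.conj (g (c v))).toMonoidHom.comp (f (ρ v))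
  have hF : ∀ (h : H) i a, F (h • Quotient.out i) a = g h * f i a * (g h)⁻¹ := by
    intro h i a
    have h1 : c (h • Quotient.out i) • Quotient.out i = h • Quotient.out i := by
      conv_rhs => rw [← hc (h • Quotient.out i)]
      congr 2
      exact (hρ h i).symm
    have h2 : h⁻¹ * c (h • Quotient.out i) ∈ MulAction.stabilizer H (Quotient.out i) := by
      rw [MulAction.mem_stabilizer_iff, mul_smul, h1, inv_smul_smul]
    obtain ⟨s, hs, hcs⟩ : ∃ s ∈ MulAction.stabilizer H (Quotient.out i),
        c (h • Quotient.out i) = h * s := ⟨_, h2, by group⟩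
    have h3 := (hstab i s hs a).eq
    change g (c (h • Quotient.out i)) * f (ρ (h • Quotient.out i)) a *
      (g (c (h • Quotient.out i)))⁻¹ = _
    rw [hρ, hcs, map_mul, mul_assoc (g h), h3]
    group
  have hv : ∀ v, ∃ i, ∃ h : H, v = h • Quotient.out i := fun v => ⟨ρ v, c v, (hc v).symm⟩
  refine ⟨F, fun h v a => ?_, fun i a => ?_⟩
  · obtain ⟨i, k, rfl⟩ := hv v
    rw [smul_smul, hF, hF, map_mul]
    group
  · conv_lhs => rw [← one_smul H (Quotient.out i)]
    rw [hF, map_one]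
    group

end GraphWreathProduct

namespace GraphWreathProduct

open SemidirectProduct

variable {A H V : Type*} [Group A] [Group H] [MulAction H V]
  (Γ : SimpleGraph V) [Γ.IsGraphAction H]

theorem fg_and_finite_orbits [Nontrivial A] [Nonempty V]
    [Group.FG (GraphWreathProduct A H Γ)] :
    Group.FG A ∧ Finite (MulAction.orbitRel.Quotient H V) := by
  obtain ⟨X, hX, hXtop⟩ := Group.FG.exists_finite_closure_image _
    (closure_range_eq_top (A := A) (H := H) Γ)
  let P : Set (V × A) := Sum.inl ⁻¹' X
  have hP : P.Finite := hX.preimage Sum.inl_injective.injOn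
  let A' : V → Subgroup A := fun v =>
    Subgroup.closure (Prod.snd '' {p ∈ P | p.1 ∈ MulAction.orbit H v})
  have hA' : ∀ (h : H) v, A' (h • v) = A' v := fun h v => by
    simp only [A', MulAction.orbit_eq_iff.2 (MulAction.mem_orbit v h)]
  let D : Subgroup (GraphWreathProduct A H Γ) :=
    { carrier := {g | ∀ v, GraphProduct.proj Γ v g.left ∈ A' v}
      one_mem' := fun v => by
        rw [one_left, map_one]
        exact one_mem _
      mul_mem' := fun {x y} hx hy v => by
        rw [mul_left, map_mul, GraphProduct.proj_action]
        exact mul_mem (hx v) (hA' x.right⁻¹ v ▸ hy _)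
      inv_mem' := fun {x} hx v => by
        rw [inv_left, GraphProduct.proj_action, map_inv]
        exact inv_mem (hA' (x.right⁻¹)⁻¹ v ▸ hx _) }
  have hD : ∀ g : GraphWreathProduct A H Γ, g ∈ D := by
    intro g
    refine (top_le_iff.2 (top_le_iff.1 (hXtop ▸ (Subgroup.closure_le D).2 ?_)) :
      ⊤ ≤ D) (Subgroup.mem_top g)
    rintro _ ⟨p | h, hp, rfl⟩ v
    · change GraphProduct.proj Γ v (GraphProduct.of Γ (A := fun _ => A) p.1 p.2) ∈ A' v
      by_cases hv : p.1 = v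
      · rw [hv, GraphProduct.proj_of_self]
        exact Subgroup.subset_closure ⟨p, ⟨hp, hv ▸ MulAction.mem_orbit_self _⟩, rfl⟩
      · rw [GraphProduct.proj_of_ne Γ hv]
        exact one_mem _
    · change GraphProduct.proj Γ v (inr h : GraphWreathProduct A H Γ).left ∈ A' v
      rw [left_inr, map_one]
      exact one_mem _
  have htop : ∀ v, A' v = ⊤ := fun v => top_le_iff.1 fun a _ => by
    have := hD (ofVertex Γ v a) v
    rwa [ofVertex, MonoidHom.comp_apply, left_inl, GraphProduct.proj_of_self] at this
  constructor
  · obtain ⟨v⟩ := ‹Nonempty V›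
    exact Group.fg_iff.2 ⟨_, htop v, (hP.subset (Set.sep_subset _ _)).image _⟩
  · have := hP.to_subtype
    refine Finite.of_surjective
      (fun p : P => (Quotient.mk (MulAction.orbitRel H V) p.1.1)) fun q => ?_
    obtain ⟨v, rfl⟩ := q.exists_rep
    by_contra! hne
    have hbot : A' v = ⊥ := by
      refine Subgroup.closure_eq_bot_iff.2 ?_
      rintro _ ⟨p, ⟨hp, hpv⟩, rfl⟩
      exact absurd (Quotient.sound (s := MulAction.orbitRel H V) hpv) (hne ⟨p, hp⟩)
    exact bot_ne_top (hbot.symm.trans (htop v))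

section Edges

/-- The graph whose edges are the translates of the pairs in `E`. -/
def orbitGraph (H : Type*) [Group H] {V : Type*} [MulAction H V] (E : Set (V × V))
    (hE : ∀ p ∈ E, p.1 ≠ p.2) : SimpleGraph V where
  Adj u v := ∃ p ∈ E, ∃ h : H, (u = h • p.1 ∧ v = h • p.2) ∨ (u = h • p.2 ∧ v = h • p.1)
  symm := ⟨fun u v ⟨p, hp, h, hh⟩ => ⟨p, hp, h, hh.symm.imp And.symm And.symm⟩⟩
  loopless := ⟨fun u ⟨p, hp, h, hh⟩ => by
    rcases hh with ⟨h1, h2⟩ | ⟨h1, h2⟩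
    · exact hE p hp (MulAction.injective h (h1.symm.trans h2))
    · exact hE p hp (MulAction.injective h (h2.symm.trans h1))⟩

instance (E : Set (V × V)) (hE : ∀ p ∈ E, p.1 ≠ p.2) :
    (orbitGraph H E hE).IsGraphAction H := by
  have key : ∀ (h : H) (u v : V), (orbitGraph H E hE).Adj u v →
      (orbitGraph H E hE).Adj (h • u) (h • v) := by
    rintro h u v ⟨p, hp, k, hk⟩
    refine ⟨p, hp, h * k, hk.imp ?_ ?_⟩ <;> rintro ⟨rfl, rfl⟩ <;> simp [mul_smul]
  exact ⟨fun h u v => ⟨fun huv => by simpa using key h⁻¹ _ _ huv, key h u v⟩⟩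

instance : (⊥ : SimpleGraph V).IsGraphAction H := ⟨fun _ _ _ => Iff.rfl⟩

theorem finite_edge_orbits [Nontrivial A] [Group.FG A] [Group.FG H]
    [Finite (MulAction.orbitRel.Quotient H V)]
    [Group.IsFinitelyPresented (GraphWreathProduct A H Γ)] :
    Finite (MulAction.orbitRel.Quotient H Γ.edgeSet) := by
  have hrep : ∀ v : V, ∃ i : MulAction.orbitRel.Quotient H V, ∃ h : H, h • Quotient.out i = v :=
    fun v => ⟨_, exists_smul_out v⟩
  let π : GraphWreathProduct A H (⊥ : SimpleGraph V) →* GraphWreathProduct A H Γ :=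
    map ⊥ (MonoidHom.id A) Γ id (fun _ _ => rfl) (fun _ _ h => h.elim)
  have hπ : Function.Surjective π :=
    map_surjective _ _ _ _ _ _ Function.surjective_id fun w => ⟨w, 1, one_smul H w⟩
  have hπv : ∀ v a, π (ofVertex ⊥ v a) = ofVertex Γ v a := fun v a => map_ofVertex ..
  have hπr : ∀ h, π (inr h) = inr h := fun h => map_inr ..
  have : Group.FG (GraphWreathProduct A H (⊥ : SimpleGraph V)) := fg_of_orbits ⊥ _ hrep
  let F : {p : (V × V) × A × A // Γ.Adj p.1.1 p.1.2} →
      GraphWreathProduct A H (⊥ : SimpleGraph V) := fun p =>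
    ofVertex ⊥ p.1.1.1 p.1.2.1 * ofVertex ⊥ p.1.1.2 p.1.2.2 /
      (ofVertex ⊥ p.1.1.2 p.1.2.2 * ofVertex ⊥ p.1.1.1 p.1.2.1)
  obtain ⟨X, hX, hker⟩ := Group.IsFinitelyPresented.exists_finite_ker_le π hπ F (by
    let mk := QuotientGroup.mk' (Subgroup.normalClosure (Set.range F))
    refine π.ker_le_of_section_mk (lift Γ (fun v => mk.comp (ofVertex ⊥ v)) (mk.comp inr) ?_ ?_)
      (hom_ext _ (fun v a => ?_) fun h => ?_)
    · intro u v huv a b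
      exact QuotientGroup.eq_iff_div_mem.2
        (Subgroup.subset_normalClosure ⟨⟨((u, v), a, b), huv⟩, rfl⟩)
    · intro h v a
      simp only [MonoidHom.comp_apply, ← map_mul, ← map_inv, ← conj_ofVertex ⊥ h v a]
    · rw [MonoidHom.comp_apply, hπv]
      exact lift_ofVertex ..
    · rw [MonoidHom.comp_apply, hπr]
      exact lift_inr ..)
  let E : Set (V × V) := (fun p : {p : (V × V) × A × A // Γ.Adj p.1.1 p.1.2} => p.1.1) '' X
  have hEadj : ∀ p ∈ E, Γ.Adj p.1 p.2 := by
    rintro _ ⟨p, -, rfl⟩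
    exact p.2
  have hE : ∀ p ∈ E, p.1 ≠ p.2 := fun p hp => (hEadj p hp).ne
  let f : GraphWreathProduct A H (⊥ : SimpleGraph V) →*
      GraphWreathProduct A H (orbitGraph H E hE) :=
    map ⊥ (MonoidHom.id A) _ id (fun _ _ => rfl) (fun _ _ h => h.elim)
  have hfv : ∀ v a, f (ofVertex ⊥ v a) = ofVertex _ v a := fun v a => map_ofVertex ..
  have hf : π.ker ≤ f.ker := by
    refine hker.trans (Subgroup.normalClosure_le_normal ?_)
    rintro _ ⟨p, hp, rfl⟩
    rw [SetLike.mem_coe, MonoidHom.mem_ker, map_div, div_eq_one, map_mul, map_mul, hfv, hfv]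
    have hadj : (orbitGraph H E hE).Adj p.1.1.1 p.1.1.2 :=
      ⟨p.1.1, ⟨p, hp, rfl⟩, 1, Or.inl ⟨(one_smul H _).symm, (one_smul H _).symm⟩⟩
    exact commute_ofVertex _ hadj _ _
  have hadj : ∀ u v, Γ.Adj u v → (orbitGraph H E hE).Adj u v := by
    intro u v huv
    obtain ⟨a, ha⟩ := exists_ne (1 : A)
    refine adj_of_commute (H := H) _ huv.ne ha ha ?_
    have h1 : F ⟨((u, v), a, a), huv⟩ ∈ f.ker := by
      refine hf (MonoidHom.mem_ker.2 ?_)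
      rw [map_div, div_eq_one, map_mul, map_mul, hπv, hπv]
      exact commute_ofVertex Γ huv a a
    rw [MonoidHom.mem_ker, map_div, div_eq_one, map_mul, map_mul, hfv, hfv] at h1
    exact h1
  have := (hX.image (fun p => p.1.1) : E.Finite).to_subtype
  refine Finite.of_surjective (fun p : E => Quotient.mk (MulAction.orbitRel H Γ.edgeSet)
    ⟨s(p.1.1, p.1.2), hEadj p.1 p.2⟩) fun q => ?_
  obtain ⟨⟨e, he⟩, rfl⟩ := q.exists_rep
  induction e with
  | _ u v =>
    obtain ⟨p, hp, h, hh⟩ := hadj u v he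
    refine ⟨⟨p, hp⟩, ((MulAction.orbitRel H Γ.edgeSet).symm ?_ |> Quotient.sound)⟩
    refine ⟨h, Subtype.ext ?_⟩
    change s(h • p.1, h • p.2) = s(u, v)
    rcases hh with ⟨rfl, rfl⟩ | ⟨rfl, rfl⟩
    · rfl
    · exact Sym2.eq_swap

end Edges

theorem isFinitelyPresented_vertexGroup [Nonempty V] [Group.FG A] [Group.FG H]
    [Finite (MulAction.orbitRel.Quotient H V)]
    [Group.IsFinitelyPresented (GraphWreathProduct A H Γ)] : Group.IsFinitelyPresented A := by
  obtain ⟨n, φ, hφ⟩ := Group.FG.exists_freeGroup_fin A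
  have hrep : ∀ v : V, ∃ i : MulAction.orbitRel.Quotient H V, ∃ h : H, h • Quotient.out i = v :=
    fun v => ⟨_, exists_smul_out v⟩
  let π : GraphWreathProduct (FreeGroup (Fin n)) H Γ →* GraphWreathProduct A H Γ :=
    map Γ φ Γ id (fun _ _ => rfl) (fun _ _ h => h)
  have hπ : Function.Surjective π :=
    map_surjective _ _ _ _ _ _ hφ fun w => ⟨w, 1, one_smul H w⟩
  have : Group.FG (GraphWreathProduct (FreeGroup (Fin n)) H Γ) := fg_of_orbits Γ _ hrep
  let F : V × φ.ker → GraphWreathProduct (FreeGroup (Fin n)) H Γ := fun p => ofVertex Γ p.1 p.2.1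
  obtain ⟨X, hX, hker⟩ := Group.IsFinitelyPresented.exists_finite_ker_le π hπ F (by
    let mk := QuotientGroup.mk' (Subgroup.normalClosure (Set.range F))
    choose f hf using fun v : V => φ.exists_comp_eq_of_surjective hφ (mk.comp (ofVertex Γ v))
      fun m hm => (QuotientGroup.eq_one_iff _).2
        (Subgroup.subset_normalClosure ⟨(v, ⟨m, hm⟩), rfl⟩)
    refine π.ker_le_of_section_mk (lift Γ f (mk.comp inr) ?_ ?_)
      (hom_ext _ (fun v a => ?_) fun h => ?_)
    · intro u v huv a b
      obtain ⟨x, rfl⟩ := hφ a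
      obtain ⟨y, rfl⟩ := hφ b
      rw [hf, hf]
      exact (commute_ofVertex Γ huv x y).map mk
    · intro h v a
      obtain ⟨x, rfl⟩ := hφ a
      simp only [hf, MonoidHom.comp_apply, ← map_mul, ← map_inv, ← conj_ofVertex Γ h v x]
    · rw [MonoidHom.comp_apply, map_ofVertex, lift_ofVertex]
      exact hf v a
    · rw [MonoidHom.comp_apply, map_inr, lift_inr]
      rfl)
  let M : Set (FreeGroup (Fin n)) := (fun p : V × φ.ker => p.2.1) '' X
  let ψ := QuotientGroup.mk' (Subgroup.normalClosure M)
  let f : GraphWreathProduct (FreeGroup (Fin n)) H Γ →*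
      GraphWreathProduct (FreeGroup (Fin n) ⧸ Subgroup.normalClosure M) H Γ :=
    map Γ ψ Γ id (fun _ _ => rfl) (fun _ _ h => h)
  have hf : π.ker ≤ f.ker := by
    refine hker.trans (Subgroup.normalClosure_le_normal ?_)
    rintro _ ⟨p, hp, rfl⟩
    have h1 : ψ p.2.1 = 1 :=
      (QuotientGroup.eq_one_iff _).2 (Subgroup.subset_normalClosure ⟨p, hp, rfl⟩)
    rw [SetLike.mem_coe, MonoidHom.mem_ker, map_ofVertex, h1, map_one]
  obtain ⟨v⟩ := ‹Nonempty V›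
  refine Group.IsFinitelyPresented.of_surjective φ hφ ⟨M, hX.image _, le_antisymm ?_ ?_⟩
  · refine Subgroup.normalClosure_le_normal ?_
    rintro _ ⟨p, -, rfl⟩
    exact p.2.2
  · intro m hm
    have h1 : ofVertex Γ v m ∈ f.ker := by
      refine hf (MonoidHom.mem_ker.2 ?_)
      rw [map_ofVertex, MonoidHom.mem_ker.1 hm, map_one]
    rw [MonoidHom.mem_ker, map_ofVertex] at h1
    exact (QuotientGroup.eq_one_iff _).1 (ofVertex_injective Γ v (h1.trans (map_one _).symm))

theorem isGraphAction_comap {W : Type*} [MulAction H W] (p : W → V)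
    (hp : ∀ (h : H) w, p (h • w) = h • p w) : (Γ.comap p).IsGraphAction H :=
  ⟨fun h u v => by
    rw [SimpleGraph.comap_adj, SimpleGraph.comap_adj, hp, hp,
      SimpleGraph.IsGraphAction.smul_adj_smul]⟩

theorem stabilizer_out_fg [Nontrivial A] [Group.FG A] [Group.FG H]
    [Finite (MulAction.orbitRel.Quotient H V)]
    [Group.IsFinitelyPresented (GraphWreathProduct A H Γ)]
    (i : MulAction.orbitRel.Quotient H V) :
    (MulAction.stabilizer H (Quotient.out i : V)).FG := by
  let p : (Σ _ : MulAction.orbitRel.Quotient H V, H) → V := fun w => w.2 • Quotient.out w.1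
  have hp : ∀ (h : H) w, p (h • w) = h • p w := fun h w => mul_smul h w.2 _
  have hps : ∀ v, ∃ w, p w = v := fun v =>
    let ⟨h, hh⟩ := exists_smul_out (H := H) v
    ⟨⟨_, h⟩, hh⟩
  have := isGraphAction_comap Γ p hp
  let π : GraphWreathProduct A H (Γ.comap p) →* GraphWreathProduct A H Γ :=
    map _ (MonoidHom.id A) Γ p hp (fun _ _ h => h)
  have hπ : Function.Surjective π := by
    refine map_surjective _ _ _ _ _ _ Function.surjective_id fun v => ?_
    obtain ⟨w, hw⟩ := hps v
    exact ⟨w, 1, (one_smul H _).trans hw⟩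
  have hπv : ∀ w a, π (ofVertex _ w a) = ofVertex Γ (p w) a := fun w a => map_ofVertex ..
  have hπr : ∀ h, π (inr h) = inr h := fun h => map_inr ..
  have : Group.FG (GraphWreathProduct A H (Γ.comap p)) :=
    fg_of_orbits _ (fun j => ⟨j, 1⟩) fun v => ⟨v.1, v.2, Sigma.ext rfl (heq_of_eq (mul_one v.2))⟩
  have hconj : ∀ (j : MulAction.orbitRel.Quotient H V) (h : H) (a : A),
      (inr h : GraphWreathProduct A H (Γ.comap p)) * ofVertex _ ⟨j, 1⟩ a * (inr h)⁻¹ =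
        ofVertex _ ⟨j, h⟩ a := by
    intro j h a
    rw [conj_ofVertex, Sigma.smul_mk, smul_eq_mul, mul_one]
  let F : {x : MulAction.orbitRel.Quotient H V × H × A //
      x.2.1 ∈ MulAction.stabilizer H (Quotient.out x.1)} →
      GraphWreathProduct A H (Γ.comap p) := fun x =>
    ofVertex _ ⟨x.1.1, x.1.2.1⟩ x.1.2.2 / ofVertex _ ⟨x.1.1, 1⟩ x.1.2.2
  obtain ⟨X, hX, hker⟩ := Group.IsFinitelyPresented.exists_finite_ker_le π hπ F (by
    let mk := QuotientGroup.mk' (Subgroup.normalClosure (Set.range F))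
    obtain ⟨f, hf, hfi⟩ := exists_equivariant_family
      (fun j => mk.comp (ofVertex (Γ.comap p) ⟨j, 1⟩)) (mk.comp inr) (by
        intro j s hs a
        refine mul_inv_eq_iff_eq_mul.1 ?_
        simp only [MonoidHom.comp_apply, ← map_mul, ← map_inv]
        rw [map_inv, hconj]
        exact QuotientGroup.eq_iff_div_mem.2
          (Subgroup.subset_normalClosure ⟨⟨(j, s, a), hs⟩, rfl⟩))
    have hfp : ∀ w a, f (p w) a = mk (ofVertex _ w a) := by
      rintro ⟨j, h⟩ a
      rw [← hf, hfi, ← hconj]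
      simp only [MonoidHom.comp_apply, map_mul, map_inv]
    refine π.ker_le_of_section_mk (lift Γ f (mk.comp inr) ?_ hf)
      (hom_ext _ (fun w a => ?_) fun h => ?_)
    · intro u v huv a b
      obtain ⟨u, rfl⟩ := hps u
      obtain ⟨v, rfl⟩ := hps v
      rw [hfp, hfp]
      exact (commute_ofVertex (Γ.comap p) huv a b).map mk
    · rw [MonoidHom.comp_apply, hπv]
      exact (lift_ofVertex ..).trans (hfp w a)
    · rw [MonoidHom.comp_apply, hπr]
      exact lift_inr ..)
  let S : MulAction.orbitRel.Quotient H V → Subgroup H := fun j =>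
    Subgroup.closure ((fun x => x.1.2.1) '' {x ∈ X | x.1.1 = j})
  have hS : ∀ j, S j ≤ MulAction.stabilizer H (Quotient.out j) := by
    intro j
    refine (Subgroup.closure_le _).2 ?_
    rintro _ ⟨x, ⟨-, rfl⟩, rfl⟩
    exact x.2
  let q : (Σ j, H ⧸ S j) → V := fun w =>
    MulAction.ofQuotientStabilizer H (Quotient.out w.1) (Subgroup.quotientMapOfLE (hS w.1) w.2)
  have hq : ∀ (h : H) w, q (h • w) = h • q w := by
    rintro h ⟨j, w⟩
    induction w using QuotientGroup.induction_on with
    | H k => exact mul_smul h k _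
  have := isGraphAction_comap Γ q hq
  let f : GraphWreathProduct A H (Γ.comap p) →* GraphWreathProduct A H (Γ.comap q) :=
    map _ (MonoidHom.id A) _ (fun w => ⟨w.1, (w.2 : H ⧸ S w.1)⟩) (fun _ _ => rfl) (fun _ _ h => h)
  have hfv : ∀ w a, f (ofVertex _ w a) = ofVertex _ ⟨w.1, (w.2 : H ⧸ S w.1)⟩ a :=
    fun w a => map_ofVertex ..
  have hf : π.ker ≤ f.ker := by
    refine hker.trans (Subgroup.normalClosure_le_normal ?_)
    rintro _ ⟨x, hx, rfl⟩
    have h1 : ((x.1.2.1 : H) : H ⧸ S x.1.1) = ((1 : H) : H ⧸ S x.1.1) :=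
      (QuotientGroup.eq.2 (by
        rw [inv_one, one_mul]
        exact Subgroup.subset_closure ⟨x, ⟨hx, rfl⟩, rfl⟩)).symm
    rw [SetLike.mem_coe, MonoidHom.mem_ker, map_div, div_eq_one, hfv, hfv, h1]
  have hle : MulAction.stabilizer H (Quotient.out i : V) ≤ S i := by
    intro s hs
    obtain ⟨a, ha⟩ := exists_ne (1 : A)
    have h1 : F ⟨(i, s, a), hs⟩ ∈ f.ker := by
      refine hf (MonoidHom.mem_ker.2 ?_)
      rw [map_div, div_eq_one, hπv, hπv]
      simp only [p, one_smul, MulAction.mem_stabilizer_iff.1 hs]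
    rw [MonoidHom.mem_ker, map_div, div_eq_one, hfv, hfv] at h1
    have h2 := eq_of_heq (Sigma.mk.inj ((ofVertex_eq_iff _ ha).1 h1)).2
    simpa using QuotientGroup.eq.1 h2.symm
  rw [le_antisymm hle (hS i)]
  exact (Subgroup.fg_iff _).2 ⟨_, rfl, (hX.subset (Set.sep_subset _ _)).image _⟩

theorem stabilizer_fg [Nontrivial A] [Group.FG A] [Group.FG H]
    [Finite (MulAction.orbitRel.Quotient H V)]
    [Group.IsFinitelyPresented (GraphWreathProduct A H Γ)] (v : V) :
    (MulAction.stabilizer H v).FG := by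
  obtain ⟨h, hh⟩ := exists_smul_out (H := H) v
  rw [← hh, MulAction.stabilizer_smul_eq_stabilizer_map_conj]
  rw [← Group.fg_iff_subgroup_fg]
  have := (Group.fg_iff_subgroup_fg _).2 (stabilizer_out_fg (A := A) Γ
    (Quotient.mk (MulAction.orbitRel H V) v))
  exact Group.fg_of_surjective (MonoidHom.subgroupMap_surjective _ _)

end GraphWreathProduct

theorem FreeGroup.commute_of_forall_of {α Q : Type*} [Group Q] (f : FreeGroup α →* Q) {z : Q}
    (h : ∀ x, Commute (f (FreeGroup.of x)) z) (w : FreeGroup α) : Commute (f w) z := by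
  have hle : ⊤ ≤ (Subgroup.centralizer {z}).comap f := by
    rw [← FreeGroup.closure_range_of, Subgroup.closure_le]
    rintro _ ⟨x, rfl⟩
    exact Subgroup.mem_centralizer_singleton_iff.2 (h x)
  exact Subgroup.mem_centralizer_singleton_iff.1 (hle (Subgroup.mem_top w))

namespace GraphWreathProduct

open SemidirectProduct

variable {A H V : Type*} [Group A] [Group H] [MulAction H V]
  (Γ : SimpleGraph V) [Γ.IsGraphAction H]

/-- The free product of `H` with a free group on `n` generators over each orbit. -/
abbrev FreeCover (H V : Type*) [Group H] [MulAction H V] (n : ℕ) : Type _ :=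
  Monoid.Coprod (FreeGroup (MulAction.orbitRel.Quotient H V × Fin n)) H

theorem exists_finite_edge_reps [Finite (MulAction.orbitRel.Quotient H Γ.edgeSet)] :
    ∃ D : Set (V × V), D.Finite ∧ (∀ d ∈ D, Γ.Adj d.1 d.2) ∧
      ∀ u v, Γ.Adj u v → ∃ d ∈ D, ∃ h : H,
        (h • d.1 = u ∧ h • d.2 = v) ∨ (h • d.1 = v ∧ h • d.2 = u) := by
  have hd : ∀ e : Γ.edgeSet, ∃ d : V × V, s(d.1, d.2) = e.1 := fun ⟨e, _⟩ => by
    induction e with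
    | _ u v => exact ⟨(u, v), rfl⟩
  choose d hd using hd
  refine ⟨Set.range fun q : MulAction.orbitRel.Quotient H Γ.edgeSet => d q.out,
    Set.finite_range _, ?_, fun u v huv => ?_⟩
  · rintro _ ⟨q, rfl⟩
    rw [← SimpleGraph.mem_edgeSet, hd]
    exact q.out.2
  · obtain ⟨h, hh⟩ := exists_smul_out (H := H) (⟨s(u, v), huv⟩ : Γ.edgeSet)
    refine ⟨_, ⟨Quotient.mk _ (⟨s(u, v), huv⟩ : Γ.edgeSet), rfl⟩, h, ?_⟩
    have h1 : Sym2.map (fun v => h • v) _ = s(u, v) := congrArg Subtype.val hh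
    rw [← hd, Sym2.map_mk] at h1
    exact Sym2.eq_iff.1 h1

theorem isFinitelyPresented [hA : Group.IsFinitelyPresented A] [Group.IsFinitelyPresented H]
    [Finite (MulAction.orbitRel.Quotient H V)]
    [Finite (MulAction.orbitRel.Quotient H Γ.edgeSet)]
    (hstab : ∀ v : V, (MulAction.stabilizer H v).FG) :
    Group.IsFinitelyPresented (GraphWreathProduct A H Γ) := by
  obtain ⟨n, φ, hφ, M, hM, hker⟩ := hA.out
  obtain ⟨D, hD, hDadj, hDrep⟩ := exists_finite_edge_reps (H := H) Γ
  choose T hT hTfin using fun i : MulAction.orbitRel.Quotient H V =>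
    (Subgroup.fg_iff _).1 (hstab (Quotient.out i))
  let ρ : V → MulAction.orbitRel.Quotient H V := Quotient.mk (MulAction.orbitRel H V)
  choose c hc using exists_smul_out (H := H) (V := V)
  let ε : MulAction.orbitRel.Quotient H V → FreeGroup (Fin n) →* FreeCover H V n := fun i =>
    Monoid.Coprod.inl.comp (FreeGroup.map (Prod.mk i))
  let κ : H →* FreeCover H V n := Monoid.Coprod.inr
  let ξ : V → Fin n → FreeCover H V n := fun v m => κ (c v) * ε (ρ v) (FreeGroup.of m) * (κ (c v))⁻¹
  let γ : FreeGroup (MulAction.orbitRel.Quotient H V × Fin n) →* GraphWreathProduct A H Γ :=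
    FreeGroup.lift fun p => ofVertex Γ (Quotient.out p.1) (φ (FreeGroup.of p.2))
  let π : FreeCover H V n →* GraphWreathProduct A H Γ := Monoid.Coprod.lift γ inr
  have hπκ : ∀ h, π (κ h) = inr h := fun h => Monoid.Coprod.lift_apply_inr ..
  have hπε : ∀ i x, π (ε i x) = ofVertex Γ (Quotient.out i) (φ x) := by
    intro i
    refine DFunLike.congr_fun (f := π.comp (ε i)) (g := (ofVertex Γ (Quotient.out i)).comp φ) ?_
    refine FreeGroup.ext_hom _ _ fun m => ?_
    exact (Monoid.Coprod.lift_apply_inl γ inr (FreeGroup.of (i, m))).trans FreeGroup.lift_apply_of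
  have hπξ : ∀ v m, π (ξ v m) = ofVertex Γ v (φ (FreeGroup.of m)) := by
    intro v m
    simp only [ξ, map_mul, map_inv, hπκ, hπε]
    rw [conj_ofVertex, hc]
  have hπ : Function.Surjective π := by
    refine surjective_of_mem_range Γ Quotient.out (fun v => ⟨_, c v, hc v⟩) π
      (fun h => ⟨κ h, hπκ h⟩) fun i a => ?_
    obtain ⟨x, rfl⟩ := hφ a
    exact ⟨ε i x, hπε i x⟩
  let R₁ : Set (FreeCover H V n) := ⋃ i, ε i '' M
  let R₂ : Set (FreeCover H V n) := ⋃ i, ⋃ m, (fun s => κ s * ε i (FreeGroup.of m) /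
    (ε i (FreeGroup.of m) * κ s)) '' T i
  let R₃ : Set (FreeCover H V n) := ⋃ m, ⋃ m', (fun d => ξ d.1 m * ξ d.2 m' / (ξ d.2 m' * ξ d.1 m)) '' D
  have hR₁ : ∀ i, ∀ x ∈ M, ε i x ∈ R₁ := fun i x hx => Set.mem_iUnion.2 ⟨i, x, hx, rfl⟩
  have hfin : (R₁ ∪ R₂ ∪ R₃).Finite :=
    ((Set.finite_iUnion fun i => hM.image _).union
      (Set.finite_iUnion fun i => Set.finite_iUnion fun m => (hTfin i).image _)).union
      (Set.finite_iUnion fun m => Set.finite_iUnion fun m' => hD.image _)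
  refine Group.IsFinitelyPresented.of_surjective π hπ ⟨R₁ ∪ R₂ ∪ R₃, hfin, le_antisymm ?_ ?_⟩
  · refine Subgroup.normalClosure_le_normal (Set.union_subset (Set.union_subset ?_ ?_) ?_)
    · refine Set.iUnion_subset fun i => ?_
      rintro _ ⟨x, hx, rfl⟩
      have h1 : φ x = 1 := MonoidHom.mem_ker.1 (hker ▸ Subgroup.subset_normalClosure hx)
      rw [SetLike.mem_coe, MonoidHom.mem_ker, hπε, h1, map_one]
    · refine Set.iUnion_subset fun i => Set.iUnion_subset fun m => ?_
      rintro _ ⟨s, hs, rfl⟩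
      have h1 : s • (Quotient.out i : V) = Quotient.out i := by
        rw [← MulAction.mem_stabilizer_iff, ← hT i]
        exact Subgroup.subset_closure hs
      rw [SetLike.mem_coe, MonoidHom.mem_ker, map_div, div_eq_one, map_mul, map_mul, hπε, hπκ,
        ← mul_inv_eq_iff_eq_mul, conj_ofVertex, h1]
    · refine Set.iUnion_subset fun m => Set.iUnion_subset fun m' => ?_
      rintro _ ⟨d, hd, rfl⟩
      rw [SetLike.mem_coe, MonoidHom.mem_ker, map_div, div_eq_one,
        map_mul π (ξ d.1 m) (ξ d.2 m'), map_mul π (ξ d.2 m') (ξ d.1 m), hπξ, hπξ]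
      exact commute_ofVertex Γ (hDadj d hd) _ _
  · let mk := QuotientGroup.mk' (Subgroup.normalClosure (R₁ ∪ R₂ ∪ R₃))
    have hmk : ∀ x y : FreeCover H V n, x * y / (y * x) ∈ R₁ ∪ R₂ ∪ R₃ → Commute (mk x) (mk y) :=
      fun x y h => QuotientGroup.eq_iff_div_mem.2 (Subgroup.subset_normalClosure h)
    choose f hf using fun i => φ.exists_comp_eq_of_surjective hφ (mk.comp (ε i)) (by
      rw [← hker]
      refine Subgroup.normalClosure_le_normal fun x hx => ?_
      exact (QuotientGroup.eq_one_iff _).2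
        (Subgroup.subset_normalClosure (Or.inl (Or.inl (hR₁ i x hx)))))
    obtain ⟨F, hF, hFi⟩ := exists_equivariant_family f (mk.comp κ) (by
      intro i s hs a
      obtain ⟨x, rfl⟩ := hφ a
      rw [hf]
      refine (FreeGroup.commute_of_forall_of _ (fun m => ?_) x).symm
      rw [← hT i] at hs
      have h1 : Subgroup.closure (T i) ≤
          (Subgroup.centralizer {mk (ε i (FreeGroup.of m))}).comap (mk.comp κ) := by
        refine (Subgroup.closure_le _).2 fun t ht => Subgroup.mem_centralizer_singleton_iff.2 ?_
        exact hmk _ _ (Or.inl (Or.inr (Set.mem_iUnion₂.2 ⟨i, m, t, ht, rfl⟩)))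
      exact (Subgroup.mem_centralizer_singleton_iff.1 (h1 hs)).symm)
    have hFξ : ∀ v m, F v (φ (FreeGroup.of m)) = mk (ξ v m) := by
      intro v m
      conv_lhs => rw [← hc v]
      rw [← hF, hFi, hf]
      simp only [ξ, MonoidHom.comp_apply, map_mul, map_inv]
      rfl
    have hFD : ∀ d ∈ D, ∀ a b, Commute (F d.1 a) (F d.2 b) := by
      intro d hd a b
      obtain ⟨x, rfl⟩ := hφ a
      obtain ⟨y, rfl⟩ := hφ b
      refine FreeGroup.commute_of_forall_of ((F d.1).comp φ) (fun m => ?_) x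
      refine (FreeGroup.commute_of_forall_of ((F d.2).comp φ) (fun m' => ?_) y).symm
      rw [MonoidHom.comp_apply, MonoidHom.comp_apply, hFξ, hFξ]
      exact (hmk _ _ (Or.inr (Set.mem_iUnion₂.2 ⟨m, m', d, hd, rfl⟩))).symm
    have hFadj : ∀ d ∈ D, ∀ (h : H) a b, Commute (F (h • d.1) a) (F (h • d.2) b) := by
      intro d hd h a b
      rw [← hF, ← hF]
      exact (hFD d hd a b).map (MulAut.conj (mk.comp κ h)).toMonoidHom
    refine π.ker_le_of_section_mk (lift Γ F (mk.comp κ) ?_ hF)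
      (Monoid.Coprod.hom_ext ?_ (MonoidHom.ext fun h => ?_))
    · intro u v huv a b
      obtain ⟨d, hd, h, ⟨rfl, rfl⟩ | ⟨rfl, rfl⟩⟩ := hDrep u v huv
      · exact hFadj d hd h a b
      · exact (hFadj d hd h b a).symm
    · ext ⟨i, m⟩
      have h1 : π (Monoid.Coprod.inl (FreeGroup.of (i, m))) =
          ofVertex Γ (Quotient.out i) (φ (FreeGroup.of m)) := hπε i (FreeGroup.of m)
      rw [MonoidHom.comp_apply, MonoidHom.comp_apply, h1, lift_ofVertex, hFi, hf]
      rfl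
    · have h1 : π (Monoid.Coprod.inr h) = inr h := hπκ h
      rw [MonoidHom.comp_apply, MonoidHom.comp_apply, h1, lift_inr]

end GraphWreathProduct

theorem mainTheorem5 (A H V : Type*) [Group A] [Group H] [MulAction H V] [Nonempty V]
    (Γ : SimpleGraph V) [Γ.IsGraphAction H] [Nontrivial A] :
    Group.IsFinitelyPresented (GraphWreathProduct A H Γ) ↔
      (Group.IsFinitelyPresented A ∧ Group.IsFinitelyPresented H) ∧
      (Finite (MulAction.orbitRel.Quotient H V) ∧
        Finite (MulAction.orbitRel.Quotient H Γ.edgeSet)) ∧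
      ∀ v : V, (MulAction.stabilizer H v).FG := by
  refine ⟨fun hG => ?_, ?_⟩
  · have hH : Group.IsFinitelyPresented H := Group.IsFinitelyPresented.of_retract
      (SemidirectProduct.rightHom : GraphWreathProduct A H Γ →* H) SemidirectProduct.inr
      SemidirectProduct.rightHom_inr
    have := Group.IsFinitelyPresented.fg H
    have := Group.IsFinitelyPresented.fg (GraphWreathProduct A H Γ)
    obtain ⟨_, _⟩ := GraphWreathProduct.fg_and_finite_orbits (A := A) (H := H) Γ
    exact ⟨⟨GraphWreathProduct.isFinitelyPresented_vertexGroup (H := H) Γ, hH⟩,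
      ⟨inferInstance, GraphWreathProduct.finite_edge_orbits (A := A) Γ⟩,
      GraphWreathProduct.stabilizer_fg (A := A) Γ⟩
  · rintro ⟨⟨_, _⟩, ⟨_, _⟩, hstab⟩
    exact GraphWreathProduct.isFinitelyPresented Γ hstab
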